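/- Let $\mathsf W$ be a non-empty standard Borel space, $\mathsf Y$ a measurable space with countably generated $\sigma$-algebra, $\mathsf X,\widehat{\mathsf Y}$ measurable spaces, and let $\Delta$ be the set of probability measures on $\mathsf W$, with the $\sigma$-algebra generated by the evaluations $\pi\mapsto\pi(B)$. Let a prior $P_W$ on $\mathsf W$, a distribution $P_{X_1}$ on $\mathsf X$, transition kernels $K_{j}(dx'\mid x,\hat y)$ ($j=1,2,\dots$), a kernel $P_{Y|X,W}(dy\mid x,w)$ and a measurable loss $\ell:\mathsf X\times\mathsf Y\times\widehat{\mathsf Y}\to\mathbb R$ be given. An (online-learned estimation) strategy is a sequence of measurable estimators $\psi_j:(\mathsf X\times\mathsf Y)^{j-1}\times\widehat{\mathsf Y}^{j-1}\times\mathsf X\to\widehat{\mathsf Y}$. In the $n$-round online problem, $W\sim P_W$ and $X_1\sim P_{X_1}$ are independent; in round $j$ the estimate $\widehat Y_j=\psi_j(Z^{j-1},\widehat Y^{j-1},X_j)$ is made, where $Z^{j-1}=((X_k,Y_k))_{k<j}$; then $Y_j$ is drawn from $P_{Y|X,W}(\cdot\mid X_j,W)$ and is revealed, and $X_{j+1}$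 is drawn from $K_j(\cdot\mid X_j,\widehat Y_j)$. Let $\pi_j=\mathbb P[W\in\cdot\mid Z^{j-1}]$. For $\pi\in\Delta$, $x\in\mathsf X$, $y\in\mathsf Y$, $\hat y\in\widehat{\mathsf Y}$ put $\tilde\ell(\pi,x,\hat y)=\int_{\mathsf W}\int_{\mathsf Y}\ell(x,y,\hat y)\,P_{Y|X,W}(dy\mid x,w)\,\pi(dw)$ and let $f(\pi,x,y)\in\Delta$ be the Bayes update of $\pi$, i.e. the regular conditional distribution of $W$ given $Y=y$ when $W\sim\pi$ and $Y\sim P_{Y|X,W}(\cdot\mid x,W)$. Define $Q^*_n=\tilde\ell$, $V^*_j(\pi,x)=\inf_{\hat y}Q^*_j(\pi,x,\hat y)$ for $j\le n$, and, for $j<n$, $$Q^*_j(\pi,x,\hat y)=\tilde\ell(\pi,x,\hat y)+\int_{\mathsf W}\int_{\mathsf Y}\int_{\mathsf X} V^*_{j+1}\big(f(\pi,x,y),x'\big)\,K_j(dx'\mid x,\hat y)\,P_{Y|X,W}(dy\mid x,w)\,\pi(dw).$$ All expectations are extended-real valued: integral of the positive part minus integral of the negative part, with the convention $\infty-\infty=-\infty$;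 iterated integrals are read as integrals against the joint law in this sense. Fix $1\le i\le n$, estimators $\psi_1,\dots,\psi_{i-1}$ for the rounds before $i$, and an arbitrary initial distribution of $X_i$: a Markov kernel $\nu$ from which $X_i$ is drawn given $(Z^{i-1},\widehat Y^{i-1})$, independently of $W$, in place of the distribution described above (a constant kernel, or the original dynamics, are special cases). Assume that for all choices of $\psi_i,\dots,\psi_n$ the negative parts of $\ell(X_j,Y_j,\widehat Y_j)$, $i\le j\le n$, have finite expectation, so that all expected losses are well defined in $(-\infty,\infty]$. Assume that for $i\le j\le n$ the infimum of $Q^*_j(\pi,x,\cdot)$ is a minimum for all $(\pi,x)$, attained at $\hat y=\psi^*_j(\pi,x)$ with $\psi^*_j:\Delta\times\mathsf X\to\widehat{\mathsf Y}$ measurable. Then $$\min_{\psi_i,\dots,\psi_n}\mathbb E\Big[\sum_{j=i}^n\ell(X_j,Y_j,\widehat Y_j)\Big]=\mathbb E\big[V^*_i(\pi_i,X_i)\big],$$ where the minimum is over all (history-dependent) estimators $\psi_i,\dots,\psi_n$, and it is attained. Moreover there are estimators $\psi_i,\dots,\psi_n$ with $\widehat Y_j=\psi^*_j(\pi_j,X_j)$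 almost surely for all $i\le j\le n$, and all such estimators achieve the minimum. -/

import Mathlib

open MeasureTheory ProbabilityTheory
open scoped ENNReal

namespace DynInf

/-- The extended expectation `∫ f⁺ dμ - ∫ f⁻ dμ` of an extended-real valued function. It is the
usual expectation, with values in `(-∞, ∞]`, as soon as `∫ f⁻ dμ < ∞`. -/
noncomputable def eexp {Ω : Type*} [MeasurableSpace Ω] (μ : Measure Ω) (f : Ω → EReal) : EReal :=
  ((∫⁻ ω, (f ω).toENNReal ∂μ : ℝ≥0∞) : EReal) - ((∫⁻ ω, (-f ω).toENNReal ∂μ : ℝ≥0∞) : EReal)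

/-- `Hist X Y A k` is the space of the data `(Z^k, Ŷ^k)` collected in the first `k` rounds: the
pairs `Z_j = (X_j, Y_j)` and the estimates `Ŷ_j`, for `j < k`. Rounds are numbered from `0`, so
that `k` is also the number of the next round; `A` is the space of estimates. -/
abbrev Hist (X Y A : Type*) (k : ℕ) : Type _ := (Fin k → X × Y) × (Fin k → A)

/-- The data of a Bayesian online-learning problem for dynamic inference: the prior `P_W`, the
distribution of the first observation, the known transition kernels (`trans k` is the conditional
distribution of `X_{k+1}` given `(X_k, Ŷ_k)`), the family `P_{Y|X,W}` of quantity-generation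
kernels, and the loss function `ℓ(x, y, ŷ)`. -/
structure Model (W X Y A : Type*) [MeasurableSpace W] [MeasurableSpace X] [MeasurableSpace Y]
    [MeasurableSpace A] where
  prior : Measure W
  init : Measure X
  trans : ℕ → Kernel (X × A) X
  gen : Kernel (X × W) Y
  loss : X → Y → A → ℝ
  prior_prob : IsProbabilityMeasure prior
  init_prob : IsProbabilityMeasure init
  trans_markov : ∀ k, IsMarkovKernel (trans k)
  gen_markov : IsMarkovKernel gen
  loss_measurable : Measurable fun p : X × Y × A => loss p.1 p.2.1 p.2.2

attribute [instance] Model.prior_prob Model.init_prob Model.trans_markov Model.gen_markov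

/-- An online-learned estimation strategy: the estimator of round `k` maps the past
`(Z^k, Ŷ^k)` and the new observation `X_k` to the estimate `Ŷ_k`. In an `n`-round problem only the
estimators of the rounds `k < n` matter. -/
structure Strategy (X Y A : Type*) [MeasurableSpace X] [MeasurableSpace Y]
    [MeasurableSpace A] where
  est : (k : ℕ) → Hist X Y A k × X → A
  measurable_est : ∀ k, Measurable (est k)

variable {W X Y A : Type*} [MeasurableSpace W] [MeasurableSpace X] [MeasurableSpace Y]
  [MeasurableSpace A]

/-- Appending one round `(x, y, ŷ)` to the data. -/
def appendRound {k : ℕ} (h : Hist X Y A k) (x : X) (y : Y) (a : A) : Hist X Y A (k + 1) :=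
  (Fin.snoc (α := fun _ => X × Y) h.1 (x, y), Fin.snoc (α := fun _ => A) h.2 a)

theorem measurable_snoc {k : ℕ} {E : Type*} [MeasurableSpace E] :
    Measurable fun p : (Fin k → E) × E => (Fin.snoc (α := fun _ => E) p.1 p.2 : Fin (k + 1) → E) := by
  refine measurable_pi_lambda _ fun j => ?_
  refine Fin.lastCases ?_ (fun j => ?_) j
  · simpa using measurable_snd
  · simp only [Fin.snoc_castSucc]
    fun_prop

/-- The kernel `(π, x) ↦ π`. -/
noncomputable def beliefKernel (W X : Type*) [MeasurableSpace W] [MeasurableSpace X] :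
    Kernel (ProbabilityMeasure W × X) W where
  toFun p := (p.1 : Measure W)
  measurable' := by
    have h : Measurable fun π : ProbabilityMeasure W => (π : Measure W) := measurable_subtype_coe
    exact h.comp measurable_fst

instance : IsMarkovKernel (beliefKernel W X) := ⟨fun p => p.1.2⟩

namespace Model

variable (M : Model W X Y A)

/-- The conditional distribution of the observation `X_k` given the data of the earlier rounds:
`P_{X_0}` in the first round, and then the transition kernel evaluated at the last observation and
the last estimate. -/
noncomputable def dynKernel : (k : ℕ) → Kernel (Hist X Y A k) X
  | 0 => Kernel.const _ M.init
  | k + 1 => (M.trans k).comap (fun h => ((h.1 (Fin.last k)).1, h.2 (Fin.last k))) (by fun_prop)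

/-- The observation kernels of the problem in which the observation of round `i` is instead drawn
from a prescribed initial (conditional) distribution `ν`, all other rounds being unchanged. -/
noncomputable def obsKernel (i : ℕ) (ν : Kernel (Hist X Y A i) X) :
    (k : ℕ) → Kernel (Hist X Y A k) X :=
  Function.update M.dynKernel i ν

instance (k : ℕ) : IsMarkovKernel (M.dynKernel k) := by
  cases k <;> (unfold dynKernel; infer_instance)

instance (i : ℕ) (ν : Kernel (Hist X Y A i) X) [IsMarkovKernel ν] (k : ℕ) :
    IsMarkovKernel (M.obsKernel i ν k) := by
  unfold obsKernel
  by_cases h : k = i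
  · subst h; rw [Function.update_self]; infer_instance
  · rw [Function.update_of_ne h]; infer_instance

/-- The joint law of `((W, (Z^k, Ŷ^k)), X_k)`, given the law `μ` of `(W, (Z^k, Ŷ^k))` and the
observation kernel `κ` of round `k`: given the past, `X_k` does not depend on `W`. -/
noncomputable def withObs {k : ℕ} (μ : Measure (W × Hist X Y A k)) (κ : Kernel (Hist X Y A k) X) :
    Measure ((W × Hist X Y A k) × X) :=
  μ ⊗ₘ Kernel.prodMkLeft W κ

/-- The joint law of `(W, (Z^k, Ŷ^k))` under the strategy `ψ`. In each round, `X_k` is drawn from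
the observation kernel, the estimate is `Ŷ_k = ψ_k(Z^k, Ŷ^k, X_k)`, and `Y_k` is drawn from
`P_{Y|X,W}(· | X_k, W)`. -/
noncomputable def law (i : ℕ) (ν : Kernel (Hist X Y A i) X) (ψ : Strategy X Y A) :
    (k : ℕ) → Measure (W × Hist X Y A k)
  | 0 => M.prior.map fun w => (w, (Fin.elim0, Fin.elim0))
  | k + 1 =>
    (withObs (law i ν ψ k) (M.obsKernel i ν k) ⊗ₘ
        M.gen.comap (fun s : (W × Hist X Y A k) × X => (s.2, s.1.1)) (by fun_prop)).map
      fun t => (t.1.1.1, appendRound t.1.1.2 t.1.2 t.2 (ψ.est k (t.1.1.2, t.1.2)))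

/-- The joint law of `((W, (Z^k, Ŷ^k)), X_k)` under the strategy `ψ`. -/
noncomputable def lawObs (i : ℕ) (ν : Kernel (Hist X Y A i) X) (ψ : Strategy X Y A) (k : ℕ) :
    Measure ((W × Hist X Y A k) × X) :=
  withObs (M.law i ν ψ k) (M.obsKernel i ν k)

theorem measurable_step (ψ : Strategy X Y A) (k : ℕ) :
    Measurable fun t : ((W × Hist X Y A k) × X) × Y =>
      (t.1.1.1, appendRound t.1.1.2 t.1.2 t.2 (ψ.est k (t.1.1.2, t.1.2))) := by
  have hψ : Measurable fun t : ((W × Hist X Y A k) × X) × Y => ψ.est k (t.1.1.2, t.1.2) :=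
    (ψ.measurable_est k).comp (by fun_prop)
  refine Measurable.prodMk (by fun_prop) (Measurable.prodMk ?_ ?_)
  · exact measurable_snoc.comp
      (f := fun t : ((W × Hist X Y A k) × X) × Y => (t.1.1.2.1, (t.1.2, t.2))) (by fun_prop)
  · exact measurable_snoc.comp
      (f := fun t : ((W × Hist X Y A k) × X) × Y => (t.1.1.2.2, ψ.est k (t.1.1.2, t.1.2)))
      (Measurable.prodMk (by fun_prop) hψ)

instance (i : ℕ) (ν : Kernel (Hist X Y A i) X) [IsMarkovKernel ν] (ψ : Strategy X Y A) (k : ℕ) :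
    IsProbabilityMeasure (M.law i ν ψ k) := by
  induction k with
  | zero =>
    unfold law
    exact Measure.isProbabilityMeasure_map (by fun_prop)
  | succ k ih =>
    unfold law withObs
    exact Measure.isProbabilityMeasure_map (measurable_step ψ k).aemeasurable

instance (i : ℕ) (ν : Kernel (Hist X Y A i) X) [IsMarkovKernel ν] (ψ : Strategy X Y A) (k : ℕ) :
    IsProbabilityMeasure (M.lawObs i ν ψ k) := by
  unfold lawObs withObs; infer_instance

/-- The loss `ℓ(X_j, Y_j, Ŷ_j)` incurred in round `j < n`, as a function of the data. -/
def roundLoss {n : ℕ} (j : Fin n) (ω : W × Hist X Y A n) : ℝ :=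
  M.loss (ω.2.1 j).1 (ω.2.1 j).2 (ω.2.2 j)

/-- The expected loss `E[∑_{j=i}^{n-1} ℓ(X_j, Y_j, Ŷ_j)]` accumulated from round `i` to the last
round of the `n`-round problem under the strategy `ψ`. -/
noncomputable def lossFrom (n i : ℕ) (ν : Kernel (Hist X Y A i) X) (ψ : Strategy X Y A) : EReal :=
  eexp (M.law i ν ψ n)
    fun ω => ((∑ j : Fin n, if i ≤ (j : ℕ) then M.roundLoss j ω else 0 : ℝ) : EReal)

section Posterior

variable [StandardBorelSpace W] [Nonempty W]

/-- The posterior distribution `P[W ∈ · | Z^k = z]` under the strategy `ψ`. -/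
noncomputable def posterior (i : ℕ) (ν : Kernel (Hist X Y A i) X) [IsMarkovKernel ν]
    (ψ : Strategy X Y A) (k : ℕ) (z : Fin k → X × Y) : ProbabilityMeasure W :=
  ⟨condDistrib (fun ω : W × Hist X Y A k => ω.1) (fun ω => ω.2.1) (M.law i ν ψ k) z, inferInstance⟩

end Posterior

/-- For a belief `π` on `W` and `x`, the joint law of `(Y, W)` when `W ∼ π` and
`Y ∼ P_{Y|X,W}(· | x, W)`. -/
noncomputable def jointYW : Kernel (ProbabilityMeasure W × X) (Y × W) :=
  (beliefKernel W X ⊗ₖ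
    M.gen.comap (fun q : (ProbabilityMeasure W × X) × W => (q.1.2, q.2)) (by fun_prop)).map
      Prod.swap

instance : IsMarkovKernel M.jointYW := by
  unfold jointYW
  exact Kernel.IsMarkovKernel.map _ measurable_swap

/-- The averaged loss `ℓ̃(π, x, ŷ) = ∫∫ ℓ(x, y, ŷ) P_{Y|X,W}(dy | x, w) π(dw)`. -/
noncomputable def avgLoss (π : ProbabilityMeasure W) (x : X) (a : A) : EReal :=
  eexp (M.jointYW (π, x)) fun p => (M.loss x p.1 a : EReal)

section DP

variable [StandardBorelSpace W] [Nonempty W] [MeasurableSpace.CountablyGenerated Y]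

/-- The Bayes update `f(π, x, y)` of the belief: the conditional distribution of `W` given `Y = y`
when `(Y, W)` has the law `jointYW (π, x)`. -/
noncomputable def bayesUpdate (π : ProbabilityMeasure W) (x : X) (y : Y) : ProbabilityMeasure W :=
  ⟨M.jointYW.condKernel ((π, x), y), inferInstance⟩

/-- The function `Q*_j` of the `n`-round problem, by backward recursion: `Q*_{n-1} = ℓ̃` and
`Q*_j(π, x, ŷ) = ℓ̃(π, x, ŷ) + E[V*_{j+1}(π_{j+1}, X_{j+1}) | π_j = π, X_j = x, Ŷ_j = ŷ]`, with
`V*_{j+1}` the minimum of `Q*_{j+1}` over the estimates. Given `π_j = π, X_j = x, Ŷ_j = ŷ`, the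
next state is `(f(π, x, Y), X')`, where `Y` has the predictive law of `Y_j` and `X'` is drawn
independently from the transition kernel. -/
noncomputable def Qstar (n j : ℕ) (π : ProbabilityMeasure W) (x : X) (a : A) : EReal :=
  if j + 1 < n then
    M.avgLoss π x a +
      eexp ((M.jointYW (π, x)).fst.prod (M.trans j (x, a)))
        fun p => ⨅ a' : A, Qstar n (j + 1) (M.bayesUpdate π x p.1) p.2 a'
  else M.avgLoss π x a
termination_by n - j

/-- The function `V*_j` of the `n`-round problem. -/
noncomputable def Vstar (n j : ℕ) (π : ProbabilityMeasure W) (x : X) : EReal :=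
  ⨅ a : A, M.Qstar n j π x a

/-- The estimator `ψstar` of round `j` is an `argmin` of `Q*_j`, chosen measurably. -/
def IsArgmin (n j : ℕ) (ψstar : ProbabilityMeasure W × X → A) : Prop :=
  Measurable ψstar ∧ ∀ π x a, M.Qstar n j π x (ψstar (π, x)) ≤ M.Qstar n j π x a

/-- From round `i` on, the strategy `ψ` makes the estimates `Ŷ_j = ψstar_j(π_j, X_j)`, where `π_j`
is the posterior distribution of `W` given `Z^j` (almost surely: a posterior distribution is only
defined up to null sets). -/
def Follows (n i : ℕ) (ν : Kernel (Hist X Y A i) X) [IsMarkovKernel ν]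
    (ψstar : ℕ → ProbabilityMeasure W × X → A) (ψ : Strategy X Y A) : Prop :=
  ∀ j, i ≤ j → j < n → ∀ᵐ s ∂(M.lawObs i ν ψ j),
    ψ.est j (s.1.2, s.2) = ψstar j (M.posterior i ν ψ j s.1.2.1, s.2)

/-- `E[V*_i(π_i, X_i)]`. -/
noncomputable def expVstar (n i : ℕ) (ν : Kernel (Hist X Y A i) X) [IsMarkovKernel ν]
    (ψ : Strategy X Y A) : EReal :=
  eexp (M.lawObs i ν ψ i) fun s => M.Vstar n i (M.posterior i ν ψ i s.1.2.1) s.2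

end DP

end Model

end DynInf

/-!
The estimates influence the observations but carry no information about `W` beyond that in the
data, so `(π_k, X_k)` is a controlled Markov state. The posterior `π_k` is computed by the
Bayes filter `belief`, a function of the data `Z^k` that depends neither on the strategy nor on the
observation kernels. By induction on the rounds, `belief` is the conditional law of `W` given
the whole past `(Z^k, Ŷ^k)` under every strategy (`lintegral_law_eq_lintegral_belief`); by
uniqueness of disintegrations it then agrees almost surely with the posterior given `Z^k` alone
(`posterior_ae_eq_belief`). Hence the joint law of one more round can be rewritten with `(Y_k, W)`
drawn from `jointYW (π_k, X_k)` (`law_succ_eq_map`, `map_infoState_lawObs_succ`).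

The rest is a verification argument. Taking expectations in the recursion for `Q*` gives
`E[Q*_k(π_k, X_k, Ŷ_k)] = E[ℓ(X_k, Y_k, Ŷ_k)] + E[V*_{k+1}(π_{k+1}, X_{k+1})]` (`expQ_of_lt`).
Since `V*_k ≤ Q*_k`, with equality at the selected estimates, backward induction yields that the
remaining expected loss is at least `E[V*_k(π_k, X_k)]`, with equality for the strategies that use
the selectors (`expValue_le_sum`).

Two points need care. Fubini's theorem and additivity hold for the extended expectation only when
negative parts are integrable (`eexp_compProd`, `eexp_add`). Integrability of the negative part of
`V*_k(π_k, X_k)` is not assumed: it follows from the hypothesis on the losses, applied to the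
strategy that switches to the selectors in round `k` (`lintegral_neg_Vstar_ne_top`). And `V*_k` is
measurable only because the infimum is attained by a measurable selector (`measurable_Qstar`).
-/

namespace DynInf

/-! ### Calculus of the extended expectation -/

section ExtendedExpectation

variable {S E : Type*} [MeasurableSpace S] [MeasurableSpace E]

/-- For `d = p - q`, the identity `d⁺ + q = p + d⁻`. It also holds for infinite values, in spite of
the convention `∞ - ∞ = -∞`. -/
theorem toENNReal_sub_add (p q : ℝ≥0∞) :
    ((p : EReal) - q).toENNReal + q = p + (-((p : EReal) - q)).toENNReal := by
  rw [EReal.toENNReal_sub (EReal.coe_ennreal_nonneg q), EReal.toENNReal_coe, EReal.toENNReal_coe]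
  rcases eq_or_ne q ⊤ with rfl | hq
  · simp
  rw [EReal.neg_sub (Or.inr (by simp)) (Or.inr (by simp [hq])), add_comm _ (q : EReal),
    ← sub_eq_add_neg, EReal.toENNReal_sub (EReal.coe_ennreal_nonneg p), EReal.toENNReal_coe,
    EReal.toENNReal_coe, tsub_add_eq_max, add_tsub_eq_max]

theorem toENNReal_neg_sub_le (p q : ℝ≥0∞) : (-((p : EReal) - q)).toENNReal ≤ q := by
  have h : -((p : EReal) - q) ≤ q := by
    rw [EReal.neg_le, sub_eq_add_neg]
    exact le_add_of_nonneg_left (EReal.coe_ennreal_nonneg p)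
  simpa using EReal.toENNReal_le_toENNReal h

theorem coe_sub_eq_of_add_eq {a b p q : ℝ≥0∞} (h : a + q = p + b) (hb : b ≠ ⊤) (hq : q ≠ ⊤) :
    (a : EReal) - b = (p : EReal) - q := by
  lift b to NNReal using hb
  lift q to NNReal using hq
  rcases eq_or_ne p ⊤ with rfl | hp
  · have ha : a = ⊤ := by simpa using h
    simp only [ha, EReal.coe_ennreal_top, EReal.coe_nnreal_eq_coe_real, EReal.top_sub_coe]
  · have ha : a ≠ ⊤ := by
      rintro rfl
      exact ENNReal.add_ne_top.2 ⟨hp, ENNReal.coe_ne_top⟩ (by rw [← h, top_add])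
    lift p to NNReal using hp
    lift a to NNReal using ha
    have h' : (a : ℝ) + q = p + b := by exact_mod_cast h
    simp only [EReal.coe_nnreal_eq_coe_real, ← EReal.coe_sub]
    exact congrArg _ (by linarith)

theorem coe_sub_add_coe_sub (p q p' q' : ℝ≥0∞) :
    ((p : EReal) - q) + ((p' : EReal) - q') =
      ((p + p' : ℝ≥0∞) : EReal) - ((q + q' : ℝ≥0∞) : EReal) := by
  rw [EReal.coe_ennreal_add, EReal.coe_ennreal_add, sub_eq_add_neg, sub_eq_add_neg, sub_eq_add_neg,
    EReal.neg_add (Or.inl (EReal.coe_ennreal_ne_bot q)) (Or.inr (EReal.coe_ennreal_ne_bot q')),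
    sub_eq_add_neg, add_add_add_comm]

theorem coe_toENNReal_sub (x : EReal) : (x.toENNReal : EReal) - ((-x).toENNReal : EReal) = x := by
  rcases le_total 0 x with h | h
  · rw [EReal.coe_toENNReal h, EReal.toENNReal_of_nonpos (EReal.neg_le_zero.2 h)]
    simp
  · rw [EReal.toENNReal_of_nonpos h, EReal.coe_toENNReal (EReal.neg_nonneg.2 h)]
    simp

/-- A difference of nonnegative functions need not be the decomposition into positive and negative
part; it nevertheless computes the extended expectation if the subtracted function is integrable. -/
theorem eexp_coe_sub {μ : Measure S} {p q : S → ℝ≥0∞} (hp : Measurable p) (hq : Measurable q)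
    (hfin : ∫⁻ s, q s ∂μ ≠ ⊤) :
    eexp μ (fun s => (p s : EReal) - q s) =
      ((∫⁻ s, p s ∂μ : ℝ≥0∞) : EReal) - ((∫⁻ s, q s ∂μ : ℝ≥0∞) : EReal) := by
  have hd : Measurable fun s => (-((p s : EReal) - q s)).toENNReal := by
    fun_prop
  refine coe_sub_eq_of_add_eq ?_
    (ne_top_of_le_ne_top hfin (lintegral_mono fun s => toENNReal_neg_sub_le _ _)) hfin
  rw [← lintegral_add_right _ hq, ← lintegral_add_right _ hd]
  exact lintegral_congr fun s => toENNReal_sub_add _ _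

theorem eexp_congr_ae {μ : Measure S} {f g : S → EReal} (h : f =ᵐ[μ] g) : eexp μ f = eexp μ g := by
  have h1 : ∀ᵐ s ∂μ, (f s).toENNReal = (g s).toENNReal := h.mono fun s hs => by rw [hs]
  have h2 : ∀ᵐ s ∂μ, (-f s).toENNReal = (-g s).toENNReal := h.mono fun s hs => by rw [hs]
  unfold eexp
  rw [lintegral_congr_ae h1, lintegral_congr_ae h2]

theorem eexp_mono_ae {μ : Measure S} {f g : S → EReal} (h : f ≤ᵐ[μ] g) : eexp μ f ≤ eexp μ g := by
  refine EReal.sub_le_sub ?_ ?_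
  · exact EReal.coe_ennreal_le_coe_ennreal_iff.2
      (lintegral_mono_ae (h.mono fun s hs => EReal.toENNReal_le_toENNReal hs))
  · exact EReal.coe_ennreal_le_coe_ennreal_iff.2
      (lintegral_mono_ae (h.mono fun s hs =>
        EReal.toENNReal_le_toENNReal (EReal.neg_le_neg_iff.2 hs)))

theorem eexp_add {μ : Measure S} {f g : S → EReal} (hf : Measurable f) (hg : Measurable g)
    (hf' : ∫⁻ s, (-f s).toENNReal ∂μ ≠ ⊤) (hg' : ∫⁻ s, (-g s).toENNReal ∂μ ≠ ⊤) :
    eexp μ (fun s => f s + g s) = eexp μ f + eexp μ g := by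
  have hnf : Measurable fun s => (-f s).toENNReal := by fun_prop
  have hng : Measurable fun s => (-g s).toENNReal := by fun_prop
  have key : (fun s => f s + g s) = fun s =>
      (((f s).toENNReal + (g s).toENNReal : ℝ≥0∞) : EReal) -
        (((-f s).toENNReal + (-g s).toENNReal : ℝ≥0∞) : EReal) := by
    funext s
    rw [← coe_sub_add_coe_sub, coe_toENNReal_sub, coe_toENNReal_sub]
  rw [key, eexp_coe_sub (by fun_prop) (by fun_prop)]
  · rw [lintegral_add_left (by fun_prop), lintegral_add_left (by fun_prop)]
    exact (coe_sub_add_coe_sub _ _ _ _).symm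
  · rw [lintegral_add_left (by fun_prop)]
    exact ENNReal.add_ne_top.2 ⟨hf', hg'⟩

theorem lintegral_neg_add_ne_top {μ : Measure S} {f g : S → EReal} (hf : Measurable f)
    (hf' : ∫⁻ s, (-f s).toENNReal ∂μ ≠ ⊤) (hg' : ∫⁻ s, (-g s).toENNReal ∂μ ≠ ⊤) :
    ∫⁻ s, (-(f s + g s)).toENNReal ∂μ ≠ ⊤ := by
  have hnf : Measurable fun s => (-f s).toENNReal := by fun_prop
  refine ne_top_of_le_ne_top (b := ∫⁻ s, (-f s).toENNReal + (-g s).toENNReal ∂μ) ?_ ?_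
  · rw [lintegral_add_left hnf]
    exact ENNReal.add_ne_top.2 ⟨hf', hg'⟩
  · refine lintegral_mono fun s => ?_
    conv_lhs => rw [← coe_toENNReal_sub (f s), ← coe_toENNReal_sub (g s), coe_sub_add_coe_sub]
    exact toENNReal_neg_sub_le _ _

theorem eexp_map {μ : Measure S} {g : S → E} (hg : Measurable g) {f : E → EReal}
    (hf : Measurable f) : eexp (μ.map g) f = eexp μ fun s => f (g s) := by
  unfold eexp
  rw [lintegral_map (by fun_prop) hg, lintegral_map (by fun_prop) hg]

/-- Fubini's theorem for extended expectations with integrable negative part. -/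
theorem eexp_compProd {μ : Measure S} [SFinite μ] {κ : Kernel S E} [IsSFiniteKernel κ]
    {f : S × E → EReal} (hf : Measurable f)
    (hf' : ∫⁻ t, (-f t).toENNReal ∂(μ ⊗ₘ κ) ≠ ⊤) :
    eexp (μ ⊗ₘ κ) f = eexp μ fun s => eexp (κ s) fun e => f (s, e) := by
  have h1 := Measure.lintegral_compProd (μ := μ) (κ := κ) hf.ereal_toENNReal
  have h2 := Measure.lintegral_compProd (μ := μ) (κ := κ) hf.neg.ereal_toENNReal
  simp only [Pi.neg_apply] at h2
  rw [h2] at hf'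
  unfold eexp
  rw [h1, h2]
  exact (eexp_coe_sub (hf.ereal_toENNReal.lintegral_kernel_prod_right')
    (hf.neg.ereal_toENNReal.lintegral_kernel_prod_right') hf').symm

/-- The negative part of an inner expectation is at most the expectation of the negative part. -/
theorem lintegral_neg_eexp_ne_top {μ : Measure S} [SFinite μ] {κ : Kernel S E} [IsSFiniteKernel κ]
    {f : S × E → EReal} (hf : Measurable f)
    (hf' : ∫⁻ t, (-f t).toENNReal ∂(μ ⊗ₘ κ) ≠ ⊤) :
    ∫⁻ s, (-eexp (κ s) fun e => f (s, e)).toENNReal ∂μ ≠ ⊤ := by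
  have h2 := Measure.lintegral_compProd (μ := μ) (κ := κ) hf.neg.ereal_toENNReal
  simp only [Pi.neg_apply] at h2
  rw [h2] at hf'
  exact ne_top_of_le_ne_top hf' (lintegral_mono fun s => toENNReal_neg_sub_le _ _)

theorem measurable_eexp_kernel {κ : Kernel S E} [IsSFiniteKernel κ] {f : S × E → EReal}
    (hf : Measurable f) : Measurable fun s => eexp (κ s) fun e => f (s, e) := by
  have h1 : Measurable fun s => ∫⁻ e, (f (s, e)).toENNReal ∂κ s :=
    hf.ereal_toENNReal.lintegral_kernel_prod_right'
  have h2 : Measurable fun s => ∫⁻ e, (-f (s, e)).toENNReal ∂κ s :=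
    hf.neg.ereal_toENNReal.lintegral_kernel_prod_right'
  unfold eexp
  fun_prop

theorem eexp_zero (μ : Measure S) : eexp μ (fun _ => 0) = 0 := by
  simp [eexp]

theorem eexp_finset_sum {ι : Type*} {μ : Measure S} (T : Finset ι)
    {f : ι → S → ℝ} (hf : ∀ j ∈ T, Measurable (f j))
    (hfin : ∀ j ∈ T, ∫⁻ s, (-(f j s : EReal)).toENNReal ∂μ ≠ ⊤) :
    eexp μ (fun s => ((∑ j ∈ T, f j s : ℝ) : EReal)) = ∑ j ∈ T, eexp μ (fun s => (f j s : EReal)) ∧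
      ∫⁻ s, (-((∑ j ∈ T, f j s : ℝ) : EReal)).toENNReal ∂μ ≠ ⊤ := by
  classical
  induction T using Finset.induction_on with
  | empty => simp [eexp_zero]
  | insert a T ha ih =>
    obtain ⟨h1, h2⟩ := ih (fun j hj => hf j (Finset.mem_insert_of_mem hj))
      (fun j hj => hfin j (Finset.mem_insert_of_mem hj))
    have hfa := (hf a (Finset.mem_insert_self a T)).coe_real_ereal
    have hfina := hfin a (Finset.mem_insert_self a T)
    have hT : Measurable fun s => ((∑ j ∈ T, f j s : ℝ) : EReal) :=
      (Finset.measurable_fun_sum T fun j hj => hf j (Finset.mem_insert_of_mem hj)).coe_real_ereal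
    simp only [Finset.sum_insert ha, EReal.coe_add]
    rw [← h1]
    exact ⟨eexp_add hfa hT hfina h2, lintegral_neg_add_ne_top hfa hfina h2⟩

end ExtendedExpectation

namespace Model

variable {W X Y A : Type*} [MeasurableSpace W] [MeasurableSpace X] [MeasurableSpace Y]
  [MeasurableSpace A] (M : Model W X Y A)

/-! ### One round of the problem -/

theorem lintegral_jointYW (π : ProbabilityMeasure W) (x : X) {f : Y × W → ℝ≥0∞}
    (hf : Measurable f) :
    ∫⁻ p, f p ∂M.jointYW (π, x) = ∫⁻ w, ∫⁻ y, f (y, w) ∂M.gen (x, w) ∂(π : Measure W) := by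
  unfold jointYW
  rw [Kernel.lintegral_map _ measurable_swap _ hf, Kernel.lintegral_compProd _ _ _ (by fun_prop)]
  rfl

theorem lintegral_lawObs (i : ℕ) (ν : Kernel (Hist X Y A i) X) [IsMarkovKernel ν]
    (ψ : Strategy X Y A) (k : ℕ) {f : (W × Hist X Y A k) × X → ℝ≥0∞} (hf : Measurable f) :
    ∫⁻ s, f s ∂M.lawObs i ν ψ k =
      ∫⁻ ω, ∫⁻ x, f (ω, x) ∂M.obsKernel i ν k ω.2 ∂M.law i ν ψ k := by
  unfold lawObs withObs
  rw [Measure.lintegral_compProd hf]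
  rfl

theorem lintegral_law_succ (i : ℕ) (ν : Kernel (Hist X Y A i) X) [IsMarkovKernel ν]
    (ψ : Strategy X Y A) (k : ℕ) {f : W × Hist X Y A (k + 1) → ℝ≥0∞} (hf : Measurable f) :
    ∫⁻ ω, f ω ∂M.law i ν ψ (k + 1) =
      ∫⁻ s, ∫⁻ y, f (s.1.1, appendRound s.1.2 s.2 y (ψ.est k (s.1.2, s.2)))
        ∂M.gen (s.2, s.1.1) ∂M.lawObs i ν ψ k := by
  rw [law, lintegral_map hf (measurable_step ψ k)]
  exact Measure.lintegral_compProd (μ := M.lawObs i ν ψ k) (hf.comp (measurable_step ψ k))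

theorem law_congr (i : ℕ) (ν : Kernel (Hist X Y A i) X) {ψ φ : Strategy X Y A} {k : ℕ}
    (h : ∀ j < k, ψ.est j = φ.est j) : M.law i ν ψ k = M.law i ν φ k := by
  induction k with
  | zero => rfl
  | succ k ih =>
    rw [law, law, ih fun j hj => h j (by omega), h k (by omega)]

theorem lawObs_congr (i : ℕ) (ν : Kernel (Hist X Y A i) X) {ψ φ : Strategy X Y A} {k : ℕ}
    (h : ∀ j < k, ψ.est j = φ.est j) : M.lawObs i ν ψ k = M.lawObs i ν φ k := by
  unfold lawObs
  rw [M.law_congr i ν h]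

theorem obsKernel_succ {i k : ℕ} (hk : i ≤ k) (ν : Kernel (Hist X Y A i) X) (h : Hist X Y A k)
    (x : X) (y : Y) (a : A) :
    M.obsKernel i ν (k + 1) (appendRound h x y a) = M.trans k (x, a) := by
  unfold obsKernel
  rw [Function.update_of_ne (by omega)]
  simp [dynKernel, Kernel.comap_apply, appendRound]

theorem measurable_filterStep (ψ : Strategy X Y A) (k : ℕ) :
    Measurable fun t : ((W × Hist X Y A k) × X) × Y × W =>
      (t.2.2, appendRound t.1.1.2 t.1.2 t.2.1 (ψ.est k (t.1.1.2, t.1.2))) :=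
  (measurable_step ψ k).comp
    (f := fun t : ((W × Hist X Y A k) × X) × Y × W => (((t.2.2, t.1.1.2), t.1.2), t.2.1))
    (by fun_prop)

/-! ### The Bayes filter -/

section Filter

variable [StandardBorelSpace W] [Nonempty W] [MeasurableSpace.CountablyGenerated Y]

theorem measurable_bayesUpdate :
    Measurable fun q : (ProbabilityMeasure W × X) × Y => M.bayesUpdate q.1.1 q.1.2 q.2 :=
  M.jointYW.condKernel.measurable.subtype_mk

/-- Redrawing `W` from the Bayes update leaves the joint law of `(Y, W)` unchanged. -/
theorem lintegral_jointYW_eq_bayesUpdate (π : ProbabilityMeasure W) (x : X) {f : Y × W → ℝ≥0∞}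
    (hf : Measurable f) :
    ∫⁻ p, f p ∂M.jointYW (π, x) =
      ∫⁻ p, ∫⁻ w, f (p.1, w) ∂(M.bayesUpdate π x p.1 : Measure W) ∂M.jointYW (π, x) := by
  have h : ∀ g : Y × W → ℝ≥0∞, Measurable g → ∫⁻ p, g p ∂M.jointYW (π, x) =
      ∫⁻ y, ∫⁻ w, g (y, w) ∂(M.bayesUpdate π x y : Measure W) ∂Kernel.fst M.jointYW (π, x) :=
    fun g hg => (ProbabilityTheory.lintegral_condKernel hg _).symm
  have hm : Measurable fun p : Y × W =>
      ∫⁻ w, f (p.1, w) ∂(M.bayesUpdate π x p.1 : Measure W) :=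
    (hf.lintegral_kernel_prod_right' (κ := M.jointYW.condKernel.comap (Prod.mk (π, x))
      measurable_prodMk_left)).comp measurable_fst
  rw [h f hf, h _ hm]
  simp

/-- The Bayes filter: the belief about `W` obtained from the prior by successive Bayes updates
along the data `z`. It involves neither the strategy nor the observation kernels. -/
noncomputable def belief : (k : ℕ) → (Fin k → X × Y) → ProbabilityMeasure W
  | 0, _ => ⟨M.prior, M.prior_prob⟩
  | k + 1, z => M.bayesUpdate (belief k (Fin.init z)) (z (Fin.last k)).1 (z (Fin.last k)).2

theorem measurable_belief (k : ℕ) : Measurable (M.belief k) := by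
  induction k with
  | zero => exact measurable_const
  | succ k ih =>
    have h1 : Measurable fun z : Fin (k + 1) → X × Y => M.belief k (Fin.init z) :=
      ih.comp (measurable_pi_lambda _ fun j => measurable_pi_apply _)
    exact M.measurable_bayesUpdate.comp
      (f := fun z : Fin (k + 1) → X × Y =>
        ((M.belief k (Fin.init z), (z (Fin.last k)).1), (z (Fin.last k)).2)) (by fun_prop)

theorem belief_appendRound {k : ℕ} (h : Hist X Y A k) (x : X) (y : Y) (a : A) :
    M.belief (k + 1) (appendRound h x y a).1 = M.bayesUpdate (M.belief k h.1) x y := by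
  simp [belief, appendRound]

/-- The kernel of the beliefs of the Bayes filter. -/
noncomputable def filterKernel (k : ℕ) : Kernel (Fin k → X × Y) W where
  toFun z := (M.belief k z : Measure W)
  measurable' := measurable_subtype_coe.comp (M.measurable_belief k)

instance (k : ℕ) : IsMarkovKernel (M.filterKernel k) := ⟨fun z => (M.belief k z).2⟩

/-- The joint law of `(Y_k, W)` given the past and the observation `X_k`, according to the Bayes
filter. -/
noncomputable def roundKernel (k : ℕ) : Kernel ((W × Hist X Y A k) × X) (Y × W) :=
  M.jointYW.comap (fun s => (M.belief k s.1.2.1, s.2))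
    (((M.measurable_belief k).comp (by fun_prop)).prodMk (by fun_prop))

instance (k : ℕ) : IsMarkovKernel (M.roundKernel (A := A) k) := by
  unfold roundKernel; infer_instance

/-- If the filter belief is the conditional law of `W` given the past, then given the past and `X_k`
the pair `(Y_k, W)` has the law `jointYW (π_k, X_k)`. -/
theorem lintegral_law_eq_of_belief (i : ℕ) (ν : Kernel (Hist X Y A i) X) [IsMarkovKernel ν]
    (ψ : Strategy X Y A) (k : ℕ)
    (hk : ∀ f : W × Hist X Y A k → ℝ≥0∞, Measurable f → ∫⁻ ω, f ω ∂M.law i ν ψ k =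
      ∫⁻ ω, ∫⁻ w, f (w, ω.2) ∂(M.belief k ω.2.1 : Measure W) ∂M.law i ν ψ k)
    {f : W × Hist X Y A (k + 1) → ℝ≥0∞} (hf : Measurable f) :
    ∫⁻ ω, f ω ∂M.law i ν ψ (k + 1) =
      ∫⁻ s, ∫⁻ p, f (p.2, appendRound s.1.2 s.2 p.1 (ψ.est k (s.1.2, s.2)))
        ∂M.jointYW (M.belief k s.1.2.1, s.2) ∂M.lawObs i ν ψ k := by
  have hf' : Measurable fun t : ((W × Hist X Y A k) × X) × Y × W =>
      f (t.2.2, appendRound t.1.1.2 t.1.2 t.2.1 (ψ.est k (t.1.1.2, t.1.2))) :=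
    hf.comp (measurable_filterStep ψ k)
  have h1 : Measurable fun s : (W × Hist X Y A k) × X =>
      ∫⁻ y, f (s.1.1, appendRound s.1.2 s.2 y (ψ.est k (s.1.2, s.2))) ∂M.gen (s.2, s.1.1) :=
    (hf.comp (measurable_step ψ k)).lintegral_kernel_prod_right'
      (κ := M.gen.comap (fun s : (W × Hist X Y A k) × X => (s.2, s.1.1)) (by fun_prop))
  have h2 : Measurable fun s : (W × Hist X Y A k) × X =>
      ∫⁻ p, f (p.2, appendRound s.1.2 s.2 p.1 (ψ.est k (s.1.2, s.2)))
        ∂M.jointYW (M.belief k s.1.2.1, s.2) :=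
    hf'.lintegral_kernel_prod_right' (κ := M.roundKernel k)
  have h3 : Measurable fun ω : W × Hist X Y A k =>
      ∫⁻ x, ∫⁻ y, f (ω.1, appendRound ω.2 x y (ψ.est k (ω.2, x))) ∂M.gen (x, ω.1)
        ∂M.obsKernel i ν k ω.2 :=
    h1.lintegral_kernel_prod_right'
      (κ := (M.obsKernel i ν k).comap (fun ω : W × Hist X Y A k => ω.2) measurable_snd)
  rw [M.lintegral_law_succ i ν ψ k hf, M.lintegral_lawObs i ν ψ k h1,
    M.lintegral_lawObs i ν ψ k h2, hk _ h3]
  refine lintegral_congr fun ω => ?_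
  -- `X_k` is drawn without reference to `W`, so the two can be drawn in either order
  dsimp only
  rw [lintegral_lintegral_swap]
  · refine lintegral_congr fun x => ?_
    rw [M.lintegral_jointYW]
    exact hf'.comp (measurable_prodMk_left (x := (ω, x)))
  · exact (h1.comp (f := fun q : W × X => ((q.1, ω.2), q.2)) (by fun_prop)).aemeasurable

/-- The filter belief is the conditional law of `W` given the whole past `(Z^k, Ŷ^k)`: redrawing `W`
from it leaves the joint law unchanged. -/
theorem lintegral_law_eq_lintegral_belief (i : ℕ) (ν : Kernel (Hist X Y A i) X) [IsMarkovKernel ν]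
    (ψ : Strategy X Y A) (k : ℕ) {f : W × Hist X Y A k → ℝ≥0∞} (hf : Measurable f) :
    ∫⁻ ω, f ω ∂M.law i ν ψ k =
      ∫⁻ ω, ∫⁻ w, f (w, ω.2) ∂(M.belief k ω.2.1 : Measure W) ∂M.law i ν ψ k := by
  induction k with
  | zero =>
    have hm : Measurable fun w : W => (w, ((Fin.elim0, Fin.elim0) : Hist X Y A 0)) := by fun_prop
    have h : ∀ ω : W × Hist X Y A 0, ∫⁻ w, f (w, ω.2) ∂(M.belief 0 ω.2.1 : Measure W) =
        ∫⁻ w, f (w, (Fin.elim0, Fin.elim0)) ∂M.prior := fun ω => by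
      rw [Subsingleton.elim ω.2 (Fin.elim0, Fin.elim0)]
      rfl
    simp only [h, lintegral_const, measure_univ, mul_one]
    exact lintegral_map hf hm
  | succ k ih =>
    have hm : Measurable fun ω : W × Hist X Y A (k + 1) =>
        ∫⁻ w, f (w, ω.2) ∂(M.belief (k + 1) ω.2.1 : Measure W) :=
      (hf.comp (f := fun t : (W × Hist X Y A (k + 1)) × W => (t.2, t.1.2))
        (by fun_prop)).lintegral_kernel_prod_right'
        (κ := (M.filterKernel (k + 1)).comap (fun ω : W × Hist X Y A (k + 1) => ω.2.1)
          (by fun_prop))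
    rw [M.lintegral_law_eq_of_belief i ν ψ k (fun g hg => ih hg) hf,
      M.lintegral_law_eq_of_belief i ν ψ k (fun g hg => ih hg) hm]
    refine lintegral_congr fun s => ?_
    -- the two sides differ in one extra draw of `W` from its conditional law given `Y_k`
    simp only [belief_appendRound]
    refine M.lintegral_jointYW_eq_bayesUpdate _ _ (f := fun p =>
      f (p.2, appendRound s.1.2 s.2 p.1 (ψ.est k (s.1.2, s.2)))) ?_
    exact hf.comp ((measurable_step ψ k).comp
      (f := fun p : Y × W => (((p.2, s.1.2), s.2), p.1)) (by fun_prop))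

/-- The recursion for the joint law, with `(Y_k, W)` drawn from its conditional law given the past
and `X_k` instead of `Y_k` from its conditional law given also `W`. -/
theorem law_succ_eq_map (i : ℕ) (ν : Kernel (Hist X Y A i) X) [IsMarkovKernel ν]
    (ψ : Strategy X Y A) (k : ℕ) :
    M.law i ν ψ (k + 1) = (M.lawObs i ν ψ k ⊗ₘ M.roundKernel k).map fun t =>
      (t.2.2, appendRound t.1.1.2 t.1.2 t.2.1 (ψ.est k (t.1.1.2, t.1.2))) := by
  have hm := measurable_filterStep (W := W) ψ k
  refine Measure.ext_of_lintegral _ fun f hf => ?_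
  rw [lintegral_map hf hm, M.lintegral_law_eq_of_belief i ν ψ k
    (fun _ hg => M.lintegral_law_eq_lintegral_belief i ν ψ k hg) hf]
  exact (Measure.lintegral_compProd (κ := M.roundKernel k) (hf.comp hm)).symm

theorem posterior_ae_eq_belief (i : ℕ) (ν : Kernel (Hist X Y A i) X) [IsMarkovKernel ν]
    (ψ : Strategy X Y A) (k : ℕ) :
    ∀ᵐ s ∂M.lawObs i ν ψ k, M.posterior i ν ψ k s.1.2.1 = M.belief k s.1.2.1 := by
  have h : condDistrib (fun ω : W × Hist X Y A k => ω.1) (fun ω => ω.2.1) (M.law i ν ψ k)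
      =ᵐ[(M.law i ν ψ k).map fun ω => ω.2.1] M.filterKernel k := by
    refine condDistrib_ae_eq_of_measure_eq_compProd _ (by fun_prop) ?_
    refine Measure.ext_of_lintegral _ fun f hf => ?_
    rw [lintegral_map hf (by fun_prop), Measure.lintegral_compProd hf,
      lintegral_map hf.lintegral_kernel_prod_right' (by fun_prop)]
    exact M.lintegral_law_eq_lintegral_belief i ν ψ k
      (f := fun ω => f (ω.2.1, ω.1)) (by fun_prop)
  have h' : ∀ᵐ ω ∂M.law i ν ψ k, M.posterior i ν ψ k ω.2.1 = M.belief k ω.2.1 :=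
    (ae_of_ae_map (by fun_prop) h).mono fun ω hω => Subtype.ext hω
  have h1 : (M.lawObs i ν ψ k).map Prod.fst = M.law i ν ψ k := Measure.fst_compProd _ _
  rw [← h1] at h'
  exact ae_of_ae_map (by fun_prop) h'

end Filter
/-! ### Measurability of the functions of the backward recursion -/

theorem measurable_est_comp (ψ : Strategy X Y A) (k : ℕ) :
    Measurable fun s : (W × Hist X Y A k) × X => ψ.est k (s.1.2, s.2) :=
  (ψ.measurable_est k).comp (by fun_prop)

theorem measurable_lossMap :
    Measurable fun p : X × Y × A => ((M.loss p.1 p.2.1 p.2.2 : ℝ) : EReal) :=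
  M.loss_measurable.coe_real_ereal

theorem measurable_roundLoss {n : ℕ} (j : Fin n) :
    Measurable (M.roundLoss j : W × Hist X Y A n → ℝ) :=
  M.loss_measurable.comp
    (f := fun ω : W × Hist X Y A n => ((ω.2.1 j).1, (ω.2.1 j).2, ω.2.2 j)) (by fun_prop)

theorem roundLoss_last_appendRound {k : ℕ} (w : W) (h : Hist X Y A k) (x : X) (y : Y) (a : A) :
    M.roundLoss (Fin.last k) (w, appendRound h x y a) = M.loss x y a := by
  simp [roundLoss, appendRound]

theorem roundLoss_castSucc_appendRound {k : ℕ} (j : Fin k) (w w' : W) (h : Hist X Y A k) (x : X)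
    (y : Y) (a : A) :
    M.roundLoss j.castSucc (w, appendRound h x y a) = M.roundLoss j (w', h) := by
  simp [roundLoss, appendRound]

/-- The conditional law of `(Y_j, X_{j+1})` given `((π_j, X_j), Ŷ_j)`. -/
noncomputable def nextKernel (j : ℕ) : Kernel ((ProbabilityMeasure W × X) × A) (Y × X) :=
  (Kernel.fst M.jointYW).comap Prod.fst measurable_fst ×ₖ
    (M.trans j).comap (fun q : (ProbabilityMeasure W × X) × A => (q.1.2, q.2)) (by fun_prop)

instance (j : ℕ) : IsMarkovKernel (M.nextKernel j) := by
  unfold nextKernel; infer_instance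

theorem nextKernel_apply (j : ℕ) (π : ProbabilityMeasure W) (x : X) (a : A) :
    M.nextKernel j ((π, x), a) = (M.jointYW (π, x)).fst.prod (M.trans j (x, a)) := by
  unfold nextKernel
  rw [Kernel.prod_apply]
  rfl

theorem measurable_avgLoss :
    Measurable fun q : (ProbabilityMeasure W × X) × A => M.avgLoss q.1.1 q.1.2 q.2 :=
  measurable_eexp_kernel
    (κ := M.jointYW.comap (Prod.fst : (ProbabilityMeasure W × X) × A → _) measurable_fst)
    (f := fun t : ((ProbabilityMeasure W × X) × A) × Y × W =>
      ((M.loss t.1.1.2 t.2.1 t.1.2 : ℝ) : EReal))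
    (M.measurable_lossMap.comp
      (f := fun t : ((ProbabilityMeasure W × X) × A) × Y × W => (t.1.1.2, t.2.1, t.1.2))
      (by fun_prop))

section Recursion

variable [StandardBorelSpace W] [Nonempty W] [MeasurableSpace.CountablyGenerated Y]

theorem Qstar_of_lt {n j : ℕ} (hj : j + 1 < n) (π : ProbabilityMeasure W) (x : X) (a : A) :
    M.Qstar n j π x a = M.avgLoss π x a + eexp (M.nextKernel j ((π, x), a))
      fun p => M.Vstar n (j + 1) (M.bayesUpdate π x p.1) p.2 := by
  rw [Qstar, if_pos hj, nextKernel_apply]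
  rfl

theorem Qstar_last {n j : ℕ} (hj : j + 1 = n) (π : ProbabilityMeasure W) (x : X) (a : A) :
    M.Qstar n j π x a = M.avgLoss π x a := by
  rw [Qstar, if_neg (by omega)]

theorem Vstar_le (n j : ℕ) (π : ProbabilityMeasure W) (x : X) (a : A) :
    M.Vstar n j π x ≤ M.Qstar n j π x a :=
  iInf_le _ a

variable {M} in
theorem IsArgmin.Vstar_eq {n j : ℕ} {φ : ProbabilityMeasure W × X → A} (h : M.IsArgmin n j φ)
    (π : ProbabilityMeasure W) (x : X) : M.Vstar n j π x = M.Qstar n j π x (φ (π, x)) :=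
  le_antisymm (M.Vstar_le n j π x _) (le_iInf fun a => h.2 π x a)

/-- Measurability propagates backwards in time: an infimum over estimates need not be measurable,
but the minimum attained by a measurable selector is. -/
theorem measurable_Qstar {n i : ℕ} {ψstar : ℕ → ProbabilityMeasure W × X → A}
    (hstar : ∀ j, i ≤ j → j < n → M.IsArgmin n j (ψstar j)) {j : ℕ} (hij : i ≤ j) (hjn : j < n) :
    Measurable fun q : (ProbabilityMeasure W × X) × A => M.Qstar n j q.1.1 q.1.2 q.2 := by
  rcases Nat.lt_or_ge (j + 1) n with h | h
  · have ih := measurable_Qstar hstar (j := j + 1) (by omega) h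
    have hψ := (hstar (j + 1) (by omega) h).1
    have hV : Measurable fun q : ProbabilityMeasure W × X => M.Vstar n (j + 1) q.1 q.2 := by
      simp only [(hstar (j + 1) (by omega) h).Vstar_eq]
      exact ih.comp (f := fun q : ProbabilityMeasure W × X => (q, ψstar (j + 1) q)) (by fun_prop)
    have hb : Measurable fun t : ((ProbabilityMeasure W × X) × A) × Y × X =>
        M.bayesUpdate t.1.1.1 t.1.1.2 t.2.1 :=
      M.measurable_bayesUpdate.comp
        (f := fun t : ((ProbabilityMeasure W × X) × A) × Y × X => (t.1.1, t.2.1)) (by fun_prop)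
    simp only [M.Qstar_of_lt h]
    exact M.measurable_avgLoss.add (measurable_eexp_kernel (κ := M.nextKernel j)
      (f := fun t => M.Vstar n (j + 1) (M.bayesUpdate t.1.1.1 t.1.1.2 t.2.1) t.2.2)
      (hV.comp (hb.prodMk (by fun_prop))))
  · simp only [M.Qstar_last (show j + 1 = n by omega)]
    exact M.measurable_avgLoss
termination_by n - j

theorem measurable_Vstar {n i : ℕ} {ψstar : ℕ → ProbabilityMeasure W × X → A}
    (hstar : ∀ j, i ≤ j → j < n → M.IsArgmin n j (ψstar j)) {j : ℕ} (hij : i ≤ j) (hjn : j < n) :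
    Measurable fun q : ProbabilityMeasure W × X => M.Vstar n j q.1 q.2 := by
  have hψ := (hstar j hij hjn).1
  simp only [(hstar j hij hjn).Vstar_eq]
  exact (M.measurable_Qstar hstar hij hjn).comp
    (f := fun q : ProbabilityMeasure W × X => (q, ψstar j q)) (by fun_prop)

/-! ### Expected loss and expected value of one round -/

/-- The information state `(π_k, X_k)`, with `π_k` computed by the Bayes filter. -/
noncomputable def infoState {k : ℕ} (s : (W × Hist X Y A k) × X) : ProbabilityMeasure W × X :=
  (M.belief k s.1.2.1, s.2)

theorem measurable_infoState (k : ℕ) :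
    Measurable (M.infoState : (W × Hist X Y A k) × X → ProbabilityMeasure W × X) :=
  ((M.measurable_belief k).comp (by fun_prop)).prodMk (by fun_prop)

variable (i : ℕ) (ν : Kernel (Hist X Y A i) X) [IsMarkovKernel ν] (ψ : Strategy X Y A)

/-- The expected loss of round `k`, computed from the joint law at the end of that round. -/
noncomputable def expRoundLoss (k : ℕ) : EReal :=
  eexp (M.law i ν ψ (k + 1)) fun ω => (M.roundLoss (Fin.last k) ω : EReal)

theorem expRoundLoss_eq_avgLoss (k : ℕ)
    (hfin : ∫⁻ ω, (-(M.roundLoss (Fin.last k) ω : EReal)).toENNReal ∂M.law i ν ψ (k + 1) ≠ ⊤) :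
    M.expRoundLoss i ν ψ k = eexp (M.lawObs i ν ψ k) (fun s =>
        M.avgLoss (M.infoState s).1 (M.infoState s).2 (ψ.est k (s.1.2, s.2))) ∧
      ∫⁻ s, (-M.avgLoss (M.infoState s).1 (M.infoState s).2 (ψ.est k (s.1.2, s.2))).toENNReal
        ∂M.lawObs i ν ψ k ≠ ⊤ := by
  have hl : Measurable fun ω : W × Hist X Y A (k + 1) => (M.roundLoss (Fin.last k) ω : EReal) :=
    (M.measurable_roundLoss _).coe_real_ereal
  have hm := measurable_filterStep (W := W) ψ k
  have hf := hl.comp hm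
  have hn : Measurable fun ω : W × Hist X Y A (k + 1) =>
      (-(M.roundLoss (Fin.last k) ω : EReal)).toENNReal := hl.neg.ereal_toENNReal
  rw [M.law_succ_eq_map i ν ψ k, lintegral_map hn hm] at hfin
  simp only [expRoundLoss, M.law_succ_eq_map i ν ψ k, eexp_map hm hl]
  simp only [Function.comp_def, roundLoss_last_appendRound] at hf hfin ⊢
  exact ⟨eexp_compProd hf hfin, lintegral_neg_eexp_ne_top hf hfin⟩

/-- The kernel of the next `(Y_k, X_{k+1})` under the strategy. -/
noncomputable def stepKernel (k : ℕ) : Kernel ((W × Hist X Y A k) × X) (Y × X) :=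
  (M.nextKernel k).comap (fun s => (M.infoState s, ψ.est k (s.1.2, s.2)))
    ((M.measurable_infoState k).prodMk (measurable_est_comp ψ k))

instance (k : ℕ) : IsMarkovKernel (M.stepKernel ψ k) := by
  unfold stepKernel; infer_instance

theorem measurable_nextInfoState (k : ℕ) :
    Measurable fun t : ((W × Hist X Y A k) × X) × Y × X =>
      (M.bayesUpdate (M.infoState t.1).1 (M.infoState t.1).2 t.2.1, t.2.2) :=
  (M.measurable_bayesUpdate.comp (f := fun t : ((W × Hist X Y A k) × X) × Y × X =>
    (M.infoState t.1, t.2.1)) (((M.measurable_infoState k).comp measurable_fst).prodMk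
      (by fun_prop))).prodMk (by fun_prop)

/-- The controlled Markov property of the information state. The observation of round `k + 1` comes
from the transition kernel, and not from `ν`, because `i ≤ k`. -/
theorem map_infoState_lawObs_succ {k : ℕ} (hk : i ≤ k) :
    (M.lawObs i ν ψ (k + 1)).map M.infoState =
      (M.lawObs i ν ψ k ⊗ₘ M.stepKernel ψ k).map fun t =>
        (M.bayesUpdate (M.infoState t.1).1 (M.infoState t.1).2 t.2.1, t.2.2) := by
  have hb := M.measurable_nextInfoState (A := A) k
  refine Measure.ext_of_lintegral _ fun f hf => ?_
  have hf' := hf.comp (M.measurable_infoState (A := A) (k + 1))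
  have hfb := hf.comp hb
  simp only [Function.comp_def] at hf' hfb
  rw [lintegral_map hf (M.measurable_infoState _), lintegral_map hf hb,
    Measure.lintegral_compProd hfb, M.lintegral_lawObs i ν ψ (k + 1) hf']
  have hi : Measurable fun ω : W × Hist X Y A (k + 1) =>
      ∫⁻ x, f (M.infoState (ω, x)) ∂M.obsKernel i ν (k + 1) ω.2 :=
    hf'.lintegral_kernel_prod_right'
      (κ := (M.obsKernel i ν (k + 1)).comap (fun ω : W × Hist X Y A (k + 1) => ω.2) measurable_snd)
  have hi' := hi.comp (measurable_filterStep ψ k)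
  simp only [Function.comp_def] at hi' ⊢
  rw [M.law_succ_eq_map i ν ψ k, lintegral_map hi (measurable_filterStep ψ k),
    Measure.lintegral_compProd hi']
  refine lintegral_congr fun s => ?_
  have hs : Measurable fun p : Y × X =>
      f (M.bayesUpdate (M.infoState s).1 (M.infoState s).2 p.1, p.2) :=
    hf.comp (hb.comp measurable_prodMk_left)
  have hs' : Measurable fun y : Y => ∫⁻ x, f (M.bayesUpdate (M.infoState s).1 (M.infoState s).2 y, x)
      ∂M.trans k (s.2, ψ.est k (s.1.2, s.2)) := hs.lintegral_prod_right'
  have h1 : M.stepKernel ψ k s = (M.jointYW (M.infoState s)).fst.prod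
      (M.trans k (s.2, ψ.est k (s.1.2, s.2))) := M.nextKernel_apply k _ _ _
  simp only [M.obsKernel_succ hk, infoState, belief_appendRound] at hs hs' h1 ⊢
  rw [h1, lintegral_prod _ hs.aemeasurable, Measure.fst, lintegral_map hs' measurable_fst]
  rfl

theorem eexp_lawObs_succ {k : ℕ} (hk : i ≤ k) {G : ProbabilityMeasure W × X → EReal}
    (hG : Measurable G)
    (hfin : ∫⁻ s, (-G (M.infoState s)).toENNReal ∂M.lawObs i ν ψ (k + 1) ≠ ⊤) :
    eexp (M.lawObs i ν ψ (k + 1)) (fun s => G (M.infoState s)) =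
      eexp (M.lawObs i ν ψ k) (fun s =>
        eexp (M.nextKernel k (M.infoState s, ψ.est k (s.1.2, s.2))) fun p =>
          G (M.bayesUpdate (M.infoState s).1 (M.infoState s).2 p.1, p.2)) ∧
    ∫⁻ s, (-eexp (M.nextKernel k (M.infoState s, ψ.est k (s.1.2, s.2))) fun p =>
          G (M.bayesUpdate (M.infoState s).1 (M.infoState s).2 p.1, p.2)).toENNReal
        ∂M.lawObs i ν ψ k ≠ ⊤ := by
  have hb := M.measurable_nextInfoState (A := A) k
  have hn : Measurable fun q => (-G q).toENNReal := hG.neg.ereal_toENNReal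
  have h := hG.comp hb
  rw [← lintegral_map hn (M.measurable_infoState _),
    M.map_infoState_lawObs_succ i ν ψ hk, lintegral_map hn hb] at hfin
  rw [← eexp_map (M.measurable_infoState _) hG, M.map_infoState_lawObs_succ i ν ψ hk,
    eexp_map hb hG]
  exact ⟨eexp_compProd h hfin, lintegral_neg_eexp_ne_top h hfin⟩

end Recursion

/-! ### Additivity of the expected loss over the rounds -/

/-- The law of the loss of a round does not change in later rounds. -/
theorem lintegral_roundLoss (i : ℕ) (ν : Kernel (Hist X Y A i) X) [IsMarkovKernel ν]
    (ψ : Strategy X Y A) {g : ℝ → ℝ≥0∞} (hg : Measurable g) {n : ℕ} (j : Fin n) :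
    ∫⁻ ω, g (M.roundLoss j ω) ∂M.law i ν ψ n =
      ∫⁻ ω, g (M.roundLoss (Fin.last j) ω) ∂M.law i ν ψ (j + 1) := by
  induction n with
  | zero => exact j.elim0
  | succ n ih =>
    induction j using Fin.lastCases with
    | last => rfl
    | cast j =>
      have h1 : Measurable fun ω : W × Hist X Y A (n + 1) => g (M.roundLoss j.castSucc ω) :=
        hg.comp (M.measurable_roundLoss _)
      have h2 : Measurable fun s : (W × Hist X Y A n) × X => g (M.roundLoss j s.1) :=
        hg.comp ((M.measurable_roundLoss j).comp measurable_fst)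
      rw [M.lintegral_law_succ i ν ψ n h1]
      simp only [fun (s : (W × Hist X Y A n) × X) y a =>
        M.roundLoss_castSucc_appendRound j s.1.1 s.1.1 s.1.2 s.2 y a, lintegral_const, measure_univ,
        mul_one]
      rw [M.lintegral_lawObs i ν ψ n h2]
      simpa using ih j

theorem eexp_roundLoss (i : ℕ) (ν : Kernel (Hist X Y A i) X) [IsMarkovKernel ν]
    (ψ : Strategy X Y A) {n : ℕ} (j : Fin n) :
    eexp (M.law i ν ψ n) (fun ω => (M.roundLoss j ω : EReal)) = M.expRoundLoss i ν ψ j := by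
  unfold expRoundLoss eexp
  rw [M.lintegral_roundLoss i ν ψ (g := fun r => (r : EReal).toENNReal) (by fun_prop) j,
    M.lintegral_roundLoss i ν ψ (g := fun r => (-(r : EReal)).toENNReal) (by fun_prop) j]

theorem lossFrom_eq_sum {n i : ℕ} (ν : Kernel (Hist X Y A i) X) [IsMarkovKernel ν]
    (ψ : Strategy X Y A)
    (hfin : ∀ j : Fin n, i ≤ (j : ℕ) →
      ∫⁻ ω, (-(M.roundLoss j ω : EReal)).toENNReal ∂M.law i ν ψ n ≠ ⊤) :
    M.lossFrom n i ν ψ = ∑ k ∈ Finset.Ico i n, M.expRoundLoss i ν ψ k := by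
  have hsum : ∑ k ∈ Finset.Ico i n, M.expRoundLoss i ν ψ k =
      ∑ j : Fin n, if i ≤ (j : ℕ) then M.expRoundLoss i ν ψ j else 0 := by
    rw [Fin.sum_univ_eq_sum_range (fun k => if i ≤ k then M.expRoundLoss i ν ψ k else 0) n,
      ← Finset.sum_filter]
    congr 1
    ext k
    simp [and_comm]
  have h := eexp_finset_sum (μ := M.law i ν ψ n) Finset.univ
    (f := fun (j : Fin n) ω => if i ≤ (j : ℕ) then M.roundLoss j ω else 0)
    (fun j _ => by
      by_cases hj : i ≤ (j : ℕ)
      · simpa only [if_pos hj] using M.measurable_roundLoss j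
      · simpa only [if_neg hj] using measurable_const)
    (fun j _ => by
      by_cases hj : i ≤ (j : ℕ)
      · simpa only [if_pos hj] using hfin j hj
      · simp [if_neg hj])
  rw [lossFrom, h.1, hsum]
  refine Finset.sum_congr rfl fun j _ => ?_
  by_cases hj : i ≤ (j : ℕ)
  · simp only [if_pos hj, M.eexp_roundLoss]
  · simp [if_neg hj, eexp_zero]

/-! ### Backward induction over the rounds -/

variable [StandardBorelSpace W] [Nonempty W] [MeasurableSpace.CountablyGenerated Y]

open Classical in
/-- The strategy `ψ` before round `m`; from round `m` on, the estimates are `φ_k(π_k, X_k)`, with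
`π_k` computed by the Bayes filter. Rounds with a nonmeasurable `φ_k` keep the estimator of `ψ`. -/
noncomputable def followFrom (m : ℕ) (φ : ℕ → ProbabilityMeasure W × X → A)
    (ψ : Strategy X Y A) : Strategy X Y A where
  est k := if m ≤ k ∧ Measurable (φ k) then fun p => φ k (M.belief k p.1.1, p.2) else ψ.est k
  measurable_est k := by
    split_ifs with h
    · exact h.2.comp (((M.measurable_belief k).comp (by fun_prop)).prodMk measurable_snd)
    · exact ψ.measurable_est k

theorem followFrom_est_of_lt {m k : ℕ} (h : k < m) (φ : ℕ → ProbabilityMeasure W × X → A)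
    (ψ : Strategy X Y A) : (M.followFrom m φ ψ).est k = ψ.est k :=
  if_neg fun h' => absurd h'.1 (by omega)

theorem followFrom_est {m k : ℕ} (h : m ≤ k) {φ : ℕ → ProbabilityMeasure W × X → A}
    (hφ : Measurable (φ k)) (ψ : Strategy X Y A) (s : (W × Hist X Y A k) × X) :
    (M.followFrom m φ ψ).est k (s.1.2, s.2) = φ k (M.infoState s) :=
  congrFun (if_pos ⟨h, hφ⟩) _

/-- `E[V*_k(π_k, X_k)]`, with `π_k` computed by the Bayes filter. -/
noncomputable def expValue (n : ℕ) {i : ℕ} (ν : Kernel (Hist X Y A i) X) (ψ : Strategy X Y A)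
    (k : ℕ) : EReal :=
  eexp (M.lawObs i ν ψ k) fun s => M.Vstar n k (M.infoState s).1 (M.infoState s).2

/-- `E[Q*_k(π_k, X_k, Ŷ_k)]`, with `π_k` computed by the Bayes filter. -/
noncomputable def expQ (n : ℕ) {i : ℕ} (ν : Kernel (Hist X Y A i) X) (ψ : Strategy X Y A)
    (k : ℕ) : EReal :=
  eexp (M.lawObs i ν ψ k) fun s =>
    M.Qstar n k (M.infoState s).1 (M.infoState s).2 (ψ.est k (s.1.2, s.2))

variable {n i : ℕ} (ν : Kernel (Hist X Y A i) X) (ψ : Strategy X Y A)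

theorem expValue_le_expQ (k : ℕ) : M.expValue n ν ψ k ≤ M.expQ n ν ψ k :=
  eexp_mono_ae (ae_of_all _ fun _ => M.Vstar_le _ _ _ _ _)

theorem expValue_eq_expQ {φ : ℕ → ProbabilityMeasure W × X → A} {k : ℕ}
    (hφ : M.IsArgmin n k (φ k))
    (h : ∀ᵐ s ∂M.lawObs i ν ψ k, ψ.est k (s.1.2, s.2) = φ k (M.infoState s)) :
    M.expValue n ν ψ k = M.expQ n ν ψ k :=
  eexp_congr_ae (h.mono fun s hs => by simp only [hs, hφ.Vstar_eq])

variable [IsMarkovKernel ν]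

theorem expVstar_eq_expValue : M.expVstar n i ν ψ = M.expValue n ν ψ i :=
  eexp_congr_ae ((M.posterior_ae_eq_belief i ν ψ i).mono fun s hs => by simp only [hs, infoState])

theorem follows_iff (φ : ℕ → ProbabilityMeasure W × X → A) :
    M.Follows n i ν φ ψ ↔ ∀ j, i ≤ j → j < n →
      ∀ᵐ s ∂M.lawObs i ν ψ j, ψ.est j (s.1.2, s.2) = φ j (M.infoState s) := by
  refine forall₃_congr fun j _ _ => Filter.eventually_congr ?_
  exact (M.posterior_ae_eq_belief i ν ψ j).mono fun s hs => by rw [hs, infoState]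

theorem expQ_last {k : ℕ} (hk : k + 1 = n)
    (hfin : ∫⁻ ω, (-(M.roundLoss (Fin.last k) ω : EReal)).toENNReal ∂M.law i ν ψ (k + 1) ≠ ⊤) :
    M.expQ n ν ψ k = M.expRoundLoss i ν ψ k ∧
      ∫⁻ s, (-M.Qstar n k (M.infoState s).1 (M.infoState s).2 (ψ.est k (s.1.2, s.2))).toENNReal
        ∂M.lawObs i ν ψ k ≠ ⊤ := by
  have h := M.expRoundLoss_eq_avgLoss i ν ψ k hfin
  simp only [expQ, M.Qstar_last hk]
  exact ⟨h.1.symm, h.2⟩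

/-- The expected form of the recursion for `Q*`. -/
theorem expQ_of_lt {k : ℕ} (hik : i ≤ k) (hk : k + 1 < n)
    (hV : Measurable fun q : ProbabilityMeasure W × X => M.Vstar n (k + 1) q.1 q.2)
    (hfin : ∫⁻ ω, (-(M.roundLoss (Fin.last k) ω : EReal)).toENNReal ∂M.law i ν ψ (k + 1) ≠ ⊤)
    (hfinV : ∫⁻ s, (-M.Vstar n (k + 1) (M.infoState s).1 (M.infoState s).2).toENNReal
      ∂M.lawObs i ν ψ (k + 1) ≠ ⊤) :
    M.expQ n ν ψ k = M.expRoundLoss i ν ψ k + M.expValue n ν ψ (k + 1) ∧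
      ∫⁻ s, (-M.Qstar n k (M.infoState s).1 (M.infoState s).2 (ψ.est k (s.1.2, s.2))).toENNReal
        ∂M.lawObs i ν ψ k ≠ ⊤ := by
  have h1 := M.expRoundLoss_eq_avgLoss i ν ψ k hfin
  have h2 := M.eexp_lawObs_succ i ν ψ hik hV hfinV
  have hq : Measurable fun s : (W × Hist X Y A k) × X => (M.infoState s, ψ.est k (s.1.2, s.2)) :=
    (M.measurable_infoState k).prodMk (measurable_est_comp ψ k)
  have hm1 := M.measurable_avgLoss.comp hq
  have hm2 : Measurable fun s : (W × Hist X Y A k) × X =>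
      eexp (M.nextKernel k (M.infoState s, ψ.est k (s.1.2, s.2))) fun p =>
        M.Vstar n (k + 1) (M.bayesUpdate (M.infoState s).1 (M.infoState s).2 p.1) p.2 :=
    measurable_eexp_kernel (κ := M.stepKernel ψ k)
      (f := fun t => M.Vstar n (k + 1)
        (M.bayesUpdate (M.infoState t.1).1 (M.infoState t.1).2 t.2.1) t.2.2)
      (hV.comp (M.measurable_nextInfoState k))
  simp only [expQ, M.Qstar_of_lt hk]
  refine ⟨?_, lintegral_neg_add_ne_top hm1 h1.2 h2.2⟩
  rw [h1.1, expValue, h2.1]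
  exact eexp_add hm1 hm2 h1.2 h2.2

variable {ν} in
/-- Along every admissible strategy the negative part of `V*_k(π_k, X_k)` has finite expectation:
it is the value of the strategy that switches to `φ` in round `k`, which is admissible as well. -/
theorem lintegral_neg_Vstar_ne_top {ψ₀ : Strategy X Y A}
    (hfin : ∀ ψ : Strategy X Y A, (∀ k < i, ψ.est k = ψ₀.est k) → ∀ k, i ≤ k → k < n →
      ∫⁻ ω, (-(M.roundLoss (Fin.last k) ω : EReal)).toENNReal ∂M.law i ν ψ (k + 1) ≠ ⊤)
    {φ : ℕ → ProbabilityMeasure W × X → A} (hφ : ∀ j, i ≤ j → j < n → M.IsArgmin n j (φ j))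
    {k : ℕ} (hik : i ≤ k) (hkn : k < n) {ψ : Strategy X Y A} (hψ : ∀ k < i, ψ.est k = ψ₀.est k) :
    ∫⁻ s, (-M.Vstar n k (M.infoState s).1 (M.infoState s).2).toENNReal
      ∂M.lawObs i ν ψ k ≠ ⊤ := by
  have hψ' : ∀ j < i, (M.followFrom k φ ψ).est j = ψ₀.est j := fun j hj => by
    rw [M.followFrom_est_of_lt (by omega), hψ j hj]
  rw [← M.lawObs_congr i ν (ψ := M.followFrom k φ ψ) (φ := ψ)
    fun j hj => M.followFrom_est_of_lt hj φ ψ]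
  have h : ∀ s : (W × Hist X Y A k) × X, M.Vstar n k (M.infoState s).1 (M.infoState s).2 =
      M.Qstar n k (M.infoState s).1 (M.infoState s).2
        ((M.followFrom k φ ψ).est k (s.1.2, s.2)) := fun s => by
    rw [M.followFrom_est le_rfl (hφ k hik hkn).1, (hφ k hik hkn).Vstar_eq]
  simp only [h]
  rcases Nat.lt_or_ge (k + 1) n with hk | hk
  · exact (M.expQ_of_lt ν _ hik hk (M.measurable_Vstar hφ (by omega) hk) (hfin _ hψ' k hik hkn)
      (lintegral_neg_Vstar_ne_top hfin hφ (by omega) hk hψ')).2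
  · exact (M.expQ_last ν _ (by omega) (hfin _ hψ' k hik hkn)).2
termination_by n - k

variable {ν} in
/-- The verification argument: the remaining expected loss is at least the expected value, with
equality if the estimates are those of `φ`. -/
theorem expValue_le_sum {ψ₀ : Strategy X Y A}
    (hfin : ∀ ψ : Strategy X Y A, (∀ k < i, ψ.est k = ψ₀.est k) → ∀ k, i ≤ k → k < n →
      ∫⁻ ω, (-(M.roundLoss (Fin.last k) ω : EReal)).toENNReal ∂M.law i ν ψ (k + 1) ≠ ⊤)
    {φ : ℕ → ProbabilityMeasure W × X → A} (hφ : ∀ j, i ≤ j → j < n → M.IsArgmin n j (φ j))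
    {k : ℕ} (hik : i ≤ k) (hkn : k < n) {ψ : Strategy X Y A} (hψ : ∀ k < i, ψ.est k = ψ₀.est k) :
    M.expValue n ν ψ k ≤ ∑ j ∈ Finset.Ico k n, M.expRoundLoss i ν ψ j ∧
      ((∀ j, i ≤ j → j < n →
        ∀ᵐ s ∂M.lawObs i ν ψ j, ψ.est j (s.1.2, s.2) = φ j (M.infoState s)) →
        ∑ j ∈ Finset.Ico k n, M.expRoundLoss i ν ψ j = M.expValue n ν ψ k) := by
  rw [Finset.sum_eq_sum_Ico_succ_bot hkn]
  rcases Nat.lt_or_ge (k + 1) n with hk | hk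
  · have ih := expValue_le_sum hfin hφ (k := k + 1) (by omega) hk hψ
    have hQ := (M.expQ_of_lt ν ψ hik hk (M.measurable_Vstar hφ (by omega) hk)
      (hfin _ hψ k hik hkn) (M.lintegral_neg_Vstar_ne_top hfin hφ (by omega) hk hψ)).1
    refine ⟨?_, fun h => ?_⟩
    · exact (M.expValue_le_expQ ν ψ k).trans (hQ.trans_le (add_le_add le_rfl ih.1))
    · rw [ih.2 h, ← hQ, M.expValue_eq_expQ ν ψ (hφ k hik hkn) (h k hik hkn)]
  · have hQ := (M.expQ_last (n := n) (k := k) ν ψ (by omega) (hfin _ hψ k hik hkn)).1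
    rw [Finset.Ico_eq_empty (by omega), Finset.sum_empty, add_zero, ← hQ]
    exact ⟨M.expValue_le_expQ ν ψ k,
      fun h => (M.expValue_eq_expQ ν ψ (hφ k hik hkn) (h k hik hkn)).symm⟩
termination_by n - k

end Model
end DynInf

theorem mainTheorem8 {W X Y A : Type*} [MeasurableSpace W] [StandardBorelSpace W] [Nonempty W]
    [MeasurableSpace X] [MeasurableSpace Y] [MeasurableSpace.CountablyGenerated Y]
    [MeasurableSpace A]
    (M : DynInf.Model W X Y A) (n i : ℕ) (hi : i < n)
    -- the (conditional) distribution of the observation in round `i`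
    (ν : ProbabilityTheory.Kernel (DynInf.Hist X Y A i) X) [ProbabilityTheory.IsMarkovKernel ν]
    -- the estimators of the rounds before `i` are those of `ψ₀`
    (ψ₀ : DynInf.Strategy X Y A)
    -- the expected losses from round `i` on are well defined, with values in `(-∞, ∞]`
    (hloss : ∀ ψ : DynInf.Strategy X Y A, (∀ k < i, ψ.est k = ψ₀.est k) →
      ∀ j : Fin n, i ≤ (j : ℕ) →
        ∫⁻ ω, ENNReal.ofReal (-(M.roundLoss j ω)) ∂(M.law i ν ψ n) ≠ ⊤)
    (ψstar : ℕ → ProbabilityMeasure W × X → A)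
    (hstar : ∀ j, i ≤ j → j < n → M.IsArgmin n j (ψstar j)) :
    IsLeast {L : EReal | ∃ ψ : DynInf.Strategy X Y A,
        (∀ k < i, ψ.est k = ψ₀.est k) ∧ L = M.lossFrom n i ν ψ}
      (M.expVstar n i ν ψ₀) ∧
    (∃ ψ : DynInf.Strategy X Y A,
      (∀ k < i, ψ.est k = ψ₀.est k) ∧ M.Follows n i ν ψstar ψ) ∧
    (∀ ψ : DynInf.Strategy X Y A, (∀ k < i, ψ.est k = ψ₀.est k) → M.Follows n i ν ψstar ψ →
      M.lossFrom n i ν ψ = M.expVstar n i ν ψ₀) := by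
  have hneg : ∀ r : ℝ, (-(r : EReal)).toENNReal = ENNReal.ofReal (-r) := fun _ => rfl
  have hfin : ∀ ψ : DynInf.Strategy X Y A, (∀ k < i, ψ.est k = ψ₀.est k) → ∀ k, i ≤ k → k < n →
      ∫⁻ ω, (-(M.roundLoss (Fin.last k) ω : EReal)).toENNReal ∂M.law i ν ψ (k + 1) ≠ ⊤ := by
    intro ψ hψ k hik hkn
    have h := hloss ψ hψ ⟨k, hkn⟩ hik
    rwa [M.lintegral_roundLoss i ν ψ (g := fun r => ENNReal.ofReal (-r)) (by fun_prop)] at h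
  have hsum : ∀ ψ : DynInf.Strategy X Y A, (∀ k < i, ψ.est k = ψ₀.est k) →
      M.lossFrom n i ν ψ = ∑ k ∈ Finset.Ico i n, M.expRoundLoss i ν ψ k :=
    fun ψ hψ => M.lossFrom_eq_sum ν ψ fun j hj => by simpa only [hneg] using hloss ψ hψ j hj
  -- the law up to the observation of round `i` depends only on the estimators before round `i`
  have hval : ∀ ψ : DynInf.Strategy X Y A, (∀ k < i, ψ.est k = ψ₀.est k) →
      M.expValue n ν ψ i = M.expVstar n i ν ψ₀ := fun ψ hψ => by
    rw [M.expVstar_eq_expValue ν, DynInf.Model.expValue, DynInf.Model.expValue,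
      M.lawObs_congr i ν hψ]
  have hopt : ∀ ψ : DynInf.Strategy X Y A, (∀ k < i, ψ.est k = ψ₀.est k) →
      M.Follows n i ν ψstar ψ → M.lossFrom n i ν ψ = M.expVstar n i ν ψ₀ := fun ψ hψ hF => by
    rw [hsum ψ hψ, ← hval ψ hψ]
    exact (M.expValue_le_sum hfin hstar le_rfl hi hψ).2 ((M.follows_iff ν ψ ψstar).1 hF)
  have hex : ∃ ψ : DynInf.Strategy X Y A,
      (∀ k < i, ψ.est k = ψ₀.est k) ∧ M.Follows n i ν ψstar ψ := by
    refine ⟨M.followFrom i ψstar ψ₀, fun k hk => M.followFrom_est_of_lt hk ψstar ψ₀,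
      (M.follows_iff ν _ ψstar).2 fun j hij hjn => ae_of_all _ fun s => ?_⟩
    exact M.followFrom_est hij (hstar j hij hjn).1 ψ₀ s
  refine ⟨⟨?_, ?_⟩, hex, hopt⟩
  · obtain ⟨ψ, hψ, hF⟩ := hex
    exact ⟨ψ, hψ, (hopt ψ hψ hF).symm⟩
  · rintro L ⟨ψ, hψ, rfl⟩
    rw [hsum ψ hψ, ← hval ψ hψ]
    exact (M.expValue_le_sum hfin hstar le_rfl hi hψ).1
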